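/- Consider the two-level nested logit choice model with $M$ nests of $N$ items each. Item $j$ of nest $i$ has a revenue $r_{ij}$ and a utility $v_{ij}>0$, and nest $i$ has a correlation parameter $\gamma_i\in[0,1]$. When the assortment combination $\mathbf S=(S_1,\dots,S_M)$ with $S_i\subseteq\{1,\dots,N\}$ is offered, the customer chooses nest $i$ with probability $V_i(S_i)^{\gamma_i}/\bigl(1+\sum_{i'}V_{i'}(S_{i'})^{\gamma_{i'}}\bigr)$, where $V_i(S_i)=\sum_{j\in S_i}v_{ij}$, and then buys item $j\in S_i$ with conditional probability $v_{ij}/V_i(S_i)$; with the remaining probability nothing is bought. Let $R(\mathbf S)$ be the expected revenue of one period and $R^*=\max_{\mathbf S}R(\mathbf S)$. A policy $\pi$ chooses in each period $t=1,\dots,T$, possibly at random, an assortment combination $\mathbf S^{(t)}$ on the basis of the (known) revenues $(r_{ij})$ and of the assortment combinations offered and the purchases observed in the previous periods; it does not know $(v_{ij})$. Theorem. There is a numerical constant $C_0>0$ such that the following holds for all integers $M,N,T$ with $M$ divisible by $4$, $N\ge 3$ and $T\ge M$, every constant $C_V\ge 1$ and every policy $\pi$. If $\gamma_1=\dots=\gamma_M=1/2$,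 then $$\sup_{\{r_{ij},v_{ij}\}}\ \sum_{t=1}^T\Bigl(R^*-\mathbb E^\pi\bigl[R(\mathbf S^{(t)})\bigr]\Bigr)\ \ge\ C_0\sqrt{MT},$$ where the supremum is over all revenues and utilities with $0\le r_{ij}\le 1$ and $0<v_{ij}\le C_V$ for all $i,j$. -/

import Mathlib

open scoped BigOperators

noncomputable section

/-- Assortment combinations `S = (S_1, …, S_M)`: one subset of the `N` items for every nest. -/
abbrev Assortment (M N : ℕ) : Type := Fin M → Finset (Fin N)

/-- What the retailer observes in one period: `none` is "no purchase", `some (i, j)` is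
"item `j` of nest `i` is bought". -/
abbrev Purchase (M N : ℕ) : Type := Option (Fin M × Fin N)

/-- A two-level nested logit model with `M` nests of `N` items each: revenues `r`, mean utilities
(preferences) `v > 0`, and correlation parameters `γ ∈ [0, 1]`. -/
structure NestedLogit (M N : ℕ) where
  r : Fin M → Fin N → ℝ
  v : Fin M → Fin N → ℝ
  γ : Fin M → ℝ
  v_pos : ∀ i j, 0 < v i j
  γ_mem : ∀ i, γ i ∈ Set.Icc (0 : ℝ) 1

namespace NestedLogit

variable {M N : ℕ} (I : NestedLogit M N)

/-- `V_i(A) = ∑_{j ∈ A} v_{ij}`. -/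
def nestUtility (i : Fin M) (A : Finset (Fin N)) : ℝ := ∑ j ∈ A, I.v i j

/-- `V_i(A) ^ γ_i`, read as `0` for an empty nest (this matters only for `γ_i = 0`). -/
def nestWeight (i : Fin M) (A : Finset (Fin N)) : ℝ :=
  if A = ∅ then 0 else I.nestUtility i A ^ I.γ i

/-- `V_0 + ∑_i V_i(S_i) ^ γ_i` with `V_0 = 1`. -/
def totalWeight (S : Assortment M N) : ℝ := 1 + ∑ i, I.nestWeight i (S i)

/-- Probability that the customer chooses nest `i` when `S` is offered. -/
def nestProb (S : Assortment M N) (i : Fin M) : ℝ := I.nestWeight i (S i) / I.totalWeight S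

/-- Probability that item `j` is bought, given that nest `i` has been chosen. -/
def itemProb (S : Assortment M N) (i : Fin M) (j : Fin N) : ℝ :=
  if j ∈ S i then I.v i j / I.nestUtility i (S i) else 0

/-- Probability of each purchase outcome when `S` is offered. -/
def choiceProb (S : Assortment M N) : Purchase M N → ℝ
  | none => 1 / I.totalWeight S
  | some (i, j) => I.nestProb S i * I.itemProb S i j

lemma nestUtility_nonneg (i : Fin M) (A : Finset (Fin N)) : 0 ≤ I.nestUtility i A :=
  Finset.sum_nonneg fun j _ => (I.v_pos i j).le

lemma nestWeight_nonneg (i : Fin M) (A : Finset (Fin N)) : 0 ≤ I.nestWeight i A := by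
  unfold nestWeight
  split_ifs
  · exact le_rfl
  · exact Real.rpow_nonneg (I.nestUtility_nonneg i A) _

lemma nestWeight_eq_rpow {i : Fin M} (h : I.γ i ≠ 0) (A : Finset (Fin N)) :
    I.nestWeight i A = I.nestUtility i A ^ I.γ i := by
  unfold nestWeight
  split_ifs with hA
  · subst hA
    simp [nestUtility, Real.zero_rpow h]
  · rfl

lemma totalWeight_pos (S : Assortment M N) : 0 < I.totalWeight S := by
  have : 0 ≤ ∑ i, I.nestWeight i (S i) := Finset.sum_nonneg fun i _ => I.nestWeight_nonneg i _
  unfold totalWeight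
  linarith

lemma choiceProb_nonneg (S : Assortment M N) (o : Purchase M N) : 0 ≤ I.choiceProb S o := by
  rcases o with _ | ⟨i, j⟩
  · exact (one_div_pos.mpr (I.totalWeight_pos S)).le
  · refine mul_nonneg (div_nonneg (I.nestWeight_nonneg i _) (I.totalWeight_pos S).le) ?_
    unfold itemProb
    split_ifs
    · exact div_nonneg (I.v_pos i j).le (I.nestUtility_nonneg i _)
    · exact le_rfl

lemma sum_itemProb (S : Assortment M N) (i : Fin M) (h : S i ≠ ∅) :
    ∑ j, I.itemProb S i j = 1 := by
  have hpos : 0 < I.nestUtility i (S i) :=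
    Finset.sum_pos (fun j _ => I.v_pos i j) (Finset.nonempty_iff_ne_empty.mpr h)
  simp only [itemProb]
  rw [Finset.sum_ite_mem, Finset.univ_inter, ← Finset.sum_div]
  exact div_self hpos.ne'

lemma sum_choiceProb (S : Assortment M N) : ∑ o, I.choiceProb S o = 1 := by
  have hi : ∀ i, ∑ j, I.nestProb S i * I.itemProb S i j = I.nestProb S i := by
    intro i
    rw [← Finset.mul_sum]
    by_cases h : S i = ∅
    · simp [nestProb, nestWeight, h]
    · rw [I.sum_itemProb S i h, mul_one]
  rw [Fintype.sum_option, Fintype.sum_prod_type]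
  simp only [choiceProb, hi]
  simp only [nestProb]
  rw [← Finset.sum_div, ← add_div]
  exact div_self (I.totalWeight_pos S).ne'

/-- The law of the customer's purchase when `S` is offered. -/
def choiceLaw (S : Assortment M N) : PMF (Purchase M N) :=
  PMF.ofFintype (fun o => ENNReal.ofReal (I.choiceProb S o)) (by
    rw [← ENNReal.ofReal_sum_of_nonneg fun o _ => I.choiceProb_nonneg S o, I.sum_choiceProb S,
      ENNReal.ofReal_one])

/-- Expected one-period revenue `R(S)`. -/
def expectedRevenue (S : Assortment M N) : ℝ :=
  ∑ i, I.nestProb S i * ∑ j ∈ S i, I.r i j * I.itemProb S i j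

/-- `R* = max_S R(S)`, over all assortment combinations. -/
def optimalRevenue : ℝ := Finset.univ.sup' Finset.univ_nonempty I.expectedRevenue

end NestedLogit

/-- A (possibly randomized) dynamic assortment planning policy. It knows the revenue parameters
`r`, but neither the utilities `v` nor the correlations `γ`. Given `r` and the offered assortment
combinations and observed purchases of the `t` past periods, it draws the assortment combination
to offer next from a probability distribution. -/
abbrev Policy (M N : ℕ) : Type :=
  (Fin M → Fin N → ℝ) → (t : ℕ) → (Fin t → Assortment M N × Purchase M N) → PMF (Assortment M N)

/-- The joint law, under model `I` and policy `π`, of what is offered and bought in the first `t`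
periods. -/
def trajectoryLaw {M N : ℕ} (I : NestedLogit M N) (π : Policy M N) :
    (t : ℕ) → PMF (Fin t → Assortment M N × Purchase M N)
  | 0 => PMF.pure Fin.elim0
  | t + 1 => (trajectoryLaw I π t).bind fun h => (π I.r t h).bind fun S =>
      (I.choiceLaw S).map fun o => Fin.snoc h (S, o)

/-- `E^π[R(S^(t))]` for a period `t` of a selling season of length `T`. -/
def expectedRevenueAt {M N : ℕ} (I : NestedLogit M N) (π : Policy M N) (T : ℕ) (t : Fin T) : ℝ :=
  ∑ ω : Fin T → Assortment M N × Purchase M N,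
    (trajectoryLaw I π T ω).toReal * I.expectedRevenue (ω t).1

/-- Expected regret `∑_{t ≤ T} (R* - E^π[R(S^(t))])`. -/
def regret {M N : ℕ} (I : NestedLogit M N) (π : Policy M N) (T : ℕ) : ℝ :=
  ∑ t : Fin T, (I.optimalRevenue - expectedRevenueAt I π T t)

/-- Nested logit models with `0 ≤ r_{ij} ≤ 1`, `0 < v_{ij} ≤ C_V` and all `γ_i = 1/2`. -/
def halfInstances (M N : ℕ) (C_V : ℝ) : Set (NestedLogit M N) :=
  {I | (∀ i j, 0 ≤ I.r i j ∧ I.r i j ≤ 1) ∧ (∀ i j, 0 < I.v i j ∧ I.v i j ≤ C_V) ∧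
    ∀ i, I.γ i = 1 / 2}

end

/-! This is an Assouad-type argument: each nest hides one bit. With revenues 1, 2/3, 0, …, 0 the
utilities are tuned so that item 0 alone is best in one type of nest and items 0 and 1 in the other,
with gain exactly `1 / (2 * M)` over the revenue level `1 / 2` in both cases. The optimal gains of
all nests thus add up to `1 / 2`. As `z - R(S)` equals `z` minus the total gain over `z`, divided by
the total weight (`sub_expectedRevenue`), the revenue `1 / 2` is attainable whatever the types.
Total weights are at most 4, so each wrongly served nest costs order `ε / M`, additively over nests
(`sum_loss_le_hardInstance`).

Flipping one bit changes utilities by a relative `O(ε)`, in a nest whose weight is `O(1 / M)` for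
every assortment. One purchase therefore has Hellinger affinity at least `1 - O(ε² / M)` between the
two models, uniformly in what is offered (`one_sub_le_affinity`), and this multiplies over periods
even for adaptive policies (`pow_le_trajectoryAffinity`). With `ε` of order `√(M / T)` the bit stays
undetectable throughout the season. Le Cam's two-point bound (`mul_le_expected_loss_add`), averaged
over all type vectors, gives regret of order `T * ε`, that is `√(M * T)`. -/

open scoped BigOperators
noncomputable section

/-! ### Affinity of trajectory laws and the two-point bound -/

/-- The common part of two probability vectors is at least half the square of their affinity. -/
lemma sq_affinity_le_sum_min {α : Type*} [Fintype α] {p q : α → ℝ} (hp : ∀ a, 0 ≤ p a)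
    (hq : ∀ a, 0 ≤ q a) (hp1 : ∑ a, p a = 1) (hq1 : ∑ a, q a = 1) :
    (∑ a, √(p a) * √(q a)) ^ 2 ≤ 2 * ∑ a, min (p a) (q a) := by
  have hmax : ∑ a, max (p a) (q a) ≤ 2 := by
    calc ∑ a, max (p a) (q a) ≤ ∑ a, (p a + q a) :=
          Finset.sum_le_sum fun a _ => max_le_add_of_nonneg (hp a) (hq a)
      _ = 2 := by rw [Finset.sum_add_distrib, hp1, hq1]; norm_num
  have hmin : 0 ≤ ∑ a, min (p a) (q a) :=
    Finset.sum_nonneg fun a _ => le_min (hp a) (hq a)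
  -- Since `p * q = min * max`, Cauchy–Schwarz applies to the minimum and maximum, and the maxima
  -- sum to at most 2.
  have heq : ∀ a, √(p a) * √(q a) = √(min (p a) (q a)) * √(max (p a) (q a)) := by
    intro a
    rcases le_total (p a) (q a) with h | h
    · rw [min_eq_left h, max_eq_right h]
    · rw [min_eq_right h, max_eq_left h, mul_comm]
  calc (∑ a, √(p a) * √(q a)) ^ 2
      = (∑ a, √(min (p a) (q a)) * √(max (p a) (q a))) ^ 2 := by simp only [heq]
    _ ≤ (∑ a, √(min (p a) (q a)) ^ 2) * ∑ a, √(max (p a) (q a)) ^ 2 :=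
        Finset.sum_mul_sq_le_sq_mul_sq _ _ _
    _ = (∑ a, min (p a) (q a)) * ∑ a, max (p a) (q a) := by
        congr 1
        · exact Finset.sum_congr rfl fun a _ => Real.sq_sqrt (le_min (hp a) (hq a))
        · exact Finset.sum_congr rfl fun a _ => Real.sq_sqrt (le_max_of_le_left (hp a))
    _ ≤ (∑ a, min (p a) (q a)) * 2 := mul_le_mul_of_nonneg_left hmax hmin
    _ = _ := mul_comm _ _

/-- The probabilities of a law on a finite type sum to one. -/
lemma PMF.sum_toReal {α : Type*} [Fintype α] (p : PMF α) : ∑ a, (p a).toReal = 1 := by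
  rw [← ENNReal.toReal_sum fun a _ => p.apply_ne_top a, ← tsum_fintype (L := .unconditional α),
    p.tsum_coe, ENNReal.toReal_one]

variable {M N : ℕ}

lemma NestedLogit.choiceLaw_toReal (I : NestedLogit M N) (S : Assortment M N)
    (o : Purchase M N) : (I.choiceLaw S o).toReal = I.choiceProb S o := by
  simp [NestedLogit.choiceLaw, ENNReal.toReal_ofReal (I.choiceProb_nonneg S o)]

/-- Appending a period is injective, so a single term survives in each of the sums coming from
`bind` and `map`. -/
lemma trajectoryLaw_snoc (I : NestedLogit M N) (π : Policy M N) (t : ℕ)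
    (h : Fin t → Assortment M N × Purchase M N) (S : Assortment M N) (o : Purchase M N) :
    trajectoryLaw I π (t + 1) (Fin.snoc h (S, o)) =
      trajectoryLaw I π t h * (π I.r t h S * I.choiceLaw S o) := by
  classical
  have key : ∀ (h' : Fin t → Assortment M N × Purchase M N) (S' : Assortment M N)
      (o' : Purchase M N),
      (Fin.snoc h (S, o) : Fin (t + 1) → Assortment M N × Purchase M N) = Fin.snoc h' (S', o') ↔
        h' = h ∧ S' = S ∧ o' = o := by
    intro h' S' o'
    rw [Fin.snoc_inj, Prod.mk.injEq]
    tauto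
  rw [trajectoryLaw, PMF.bind_apply, tsum_eq_single h, PMF.bind_apply, tsum_eq_single S,
    PMF.map_apply, tsum_eq_single o]
  · simp
  · intro o' ho'
    rw [if_neg]
    rw [key]
    tauto
  · intro S' hS'
    rw [PMF.map_apply, ENNReal.tsum_eq_zero.mpr, mul_zero]
    intro o'
    rw [if_neg]
    rw [key]
    tauto
  · intro h' hh'
    rw [PMF.bind_apply, ENNReal.tsum_eq_zero.mpr, mul_zero]
    intro S'
    rw [PMF.map_apply, ENNReal.tsum_eq_zero.mpr, mul_zero]
    intro o'
    rw [if_neg]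
    rw [key]
    tauto

/-- Affinity of the laws of the first `t` periods under two models with the same revenues. -/
def trajectoryAffinity (I J : NestedLogit M N) (π : Policy M N) (t : ℕ) : ℝ :=
  ∑ ω, √(trajectoryLaw I π t ω).toReal * √(trajectoryLaw J π t ω).toReal

/-- If the laws of a single purchase have affinity at least `c` whatever is offered, then the laws
of `t` periods have affinity at least `c ^ t`. -/
lemma pow_le_trajectoryAffinity {I J : NestedLogit M N} (hr : I.r = J.r) (π : Policy M N) {c : ℝ}
    (hc : 0 ≤ c) (hstep : ∀ S, c ≤ ∑ o, √(I.choiceProb S o) * √(J.choiceProb S o)) (t : ℕ) :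
    c ^ t ≤ trajectoryAffinity I J π t := by
  induction t with
  | zero =>
    have h0 : ∀ ω : Fin 0 → Assortment M N × Purchase M N, ω = Fin.elim0 :=
      fun ω => Subsingleton.elim _ _
    simp [trajectoryAffinity, trajectoryLaw, PMF.pure_apply, h0]
  | succ t ih =>
    have hsum : trajectoryAffinity I J π (t + 1) =
        ∑ h, (√(trajectoryLaw I π t h).toReal * √(trajectoryLaw J π t h).toReal) *
          ∑ S, (π I.r t h S).toReal * ∑ o, √(I.choiceProb S o) * √(J.choiceProb S o) := by
      rw [trajectoryAffinity,
        ← (Fin.snocEquiv fun _ => Assortment M N × Purchase M N).sum_comp,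
        Fintype.sum_prod_type_right]
      refine Finset.sum_congr rfl fun h _ => ?_
      rw [Fintype.sum_prod_type, Finset.mul_sum]
      refine Finset.sum_congr rfl fun S _ => ?_
      rw [Finset.mul_sum, Finset.mul_sum]
      refine Finset.sum_congr rfl fun o _ => ?_
      have e : (Fin.snocEquiv fun _ => Assortment M N × Purchase M N) ((S, o), h) =
        (Fin.snoc h (S, o) : Fin (t + 1) → Assortment M N × Purchase M N) := rfl
      rw [e, trajectoryLaw_snoc, trajectoryLaw_snoc, ← hr]
      simp only [ENNReal.toReal_mul, NestedLogit.choiceLaw_toReal]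
      rw [Real.sqrt_mul ENNReal.toReal_nonneg, Real.sqrt_mul ENNReal.toReal_nonneg,
        Real.sqrt_mul ENNReal.toReal_nonneg, Real.sqrt_mul ENNReal.toReal_nonneg]
      -- Equal revenues and equal histories make the policy randomize identically in both models, so
      -- its two square roots recombine into one probability.
      have := Real.mul_self_sqrt (ENNReal.toReal_nonneg (a := π I.r t h S))
      linear_combination (√(trajectoryLaw I π t h).toReal * √(trajectoryLaw J π t h).toReal *
        √(I.choiceProb S o) * √(J.choiceProb S o)) * this
    have hinner : ∀ h, c ≤ ∑ S, (π I.r t h S).toReal *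
        ∑ o, √(I.choiceProb S o) * √(J.choiceProb S o) := by
      intro h
      calc c = ∑ S, (π I.r t h S).toReal * c := by
            rw [← Finset.sum_mul, PMF.sum_toReal, one_mul]
        _ ≤ _ := Finset.sum_le_sum fun S _ =>
            mul_le_mul_of_nonneg_left (hstep S) ENNReal.toReal_nonneg
    rw [hsum, pow_succ]
    calc c ^ t * c ≤ trajectoryAffinity I J π t * c := mul_le_mul_of_nonneg_right ih hc
      _ = ∑ h, (√(trajectoryLaw I π t h).toReal * √(trajectoryLaw J π t h).toReal) * c := by
          rw [trajectoryAffinity, Finset.sum_mul]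
      _ ≤ _ := Finset.sum_le_sum fun h _ =>
          mul_le_mul_of_nonneg_left (hinner h) (by positivity)

/-- Two-point bound: if no single decision has small loss under both of two models that are hard to
tell apart, then the two expected losses cannot both be small. -/
lemma mul_le_expected_loss_add {I J : NestedLogit M N} (hr : I.r = J.r) (π : Policy M N)
    {η : ℝ} {T : ℕ} (hη : η ≤ 1) (hT : T * η ≤ 1 / 2)
    (hstep : ∀ S, 1 - η ≤ ∑ o, √(I.choiceProb S o) * √(J.choiceProb S o))
    {f g : Assortment M N → ℝ} {δ : ℝ} (hf : ∀ S, 0 ≤ f S) (hg : ∀ S, 0 ≤ g S)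
    (hδ : 0 ≤ δ) (hfg : ∀ S, δ ≤ f S + g S) (t : Fin T) :
    δ / 8 ≤ ∑ ω, (trajectoryLaw I π T ω).toReal * f (ω t).1 +
      ∑ ω, (trajectoryLaw J π T ω).toReal * g (ω t).1 := by
  set P := fun ω => (trajectoryLaw I π T ω).toReal with hP
  set Q := fun ω => (trajectoryLaw J π T ω).toReal with hQ
  have hP0 : ∀ ω, 0 ≤ P ω := fun ω => ENNReal.toReal_nonneg
  have hQ0 : ∀ ω, 0 ≤ Q ω := fun ω => ENNReal.toReal_nonneg
  -- Bernoulli's inequality: `(1 - η) ^ T ≥ 1 - T * η`.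
  have haff : 1 / 2 ≤ trajectoryAffinity I J π T := by
    have h1 := pow_le_trajectoryAffinity hr π (sub_nonneg.mpr hη) hstep T
    have h2 := one_add_mul_le_pow (a := -η) (by linarith) T
    rw [← sub_eq_add_neg] at h2
    linarith
  have hmin : 1 / 8 ≤ ∑ ω, min (P ω) (Q ω) := by
    have h1 := sq_affinity_le_sum_min hP0 hQ0 (PMF.sum_toReal _) (PMF.sum_toReal _)
    change trajectoryAffinity I J π T ^ 2 ≤ _ at h1
    nlinarith
  calc δ / 8 ≤ (∑ ω, min (P ω) (Q ω)) * δ := by nlinarith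
    _ = ∑ ω, min (P ω) (Q ω) * δ := Finset.sum_mul ..
    _ ≤ ∑ ω, (P ω * f (ω t).1 + Q ω * g (ω t).1) := by
        refine Finset.sum_le_sum fun ω _ => ?_
        have h0 : 0 ≤ min (P ω) (Q ω) := le_min (hP0 ω) (hQ0 ω)
        calc min (P ω) (Q ω) * δ ≤ min (P ω) (Q ω) * (f (ω t).1 + g (ω t).1) :=
              mul_le_mul_of_nonneg_left (hfg _) h0
          _ = min (P ω) (Q ω) * f (ω t).1 + min (P ω) (Q ω) * g (ω t).1 := mul_add ..
          _ ≤ _ := add_le_add (mul_le_mul_of_nonneg_right (min_le_left _ _) (hf _))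
              (mul_le_mul_of_nonneg_right (min_le_right _ _) (hg _))
    _ = _ := Finset.sum_add_distrib
end

/-! ### Affinity of single purchases under a perturbation of one nest -/

noncomputable section

/-- The affinity of two normalized weight vectors of mass at least one, in terms of the distance of
the square roots of the weights. -/
lemma one_sub_le_affinity_div {α : Type*} [Fintype α] {a b : α → ℝ} (ha : ∀ o, 0 ≤ a o)
    (hb : ∀ o, 0 ≤ b o) (hA : 1 ≤ ∑ o, a o) (hB : 1 ≤ ∑ o, b o) :
    1 - (∑ o, (√(a o) - √(b o)) ^ 2) / 2 ≤
      ∑ o, √(a o / ∑ o', a o') * √(b o / ∑ o', b o') := by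
  set A := ∑ o, a o with hAdef
  set B := ∑ o, b o with hBdef
  set D := ∑ o, (√(a o) - √(b o)) ^ 2 with hD
  have hsA : 1 ≤ √A := Real.one_le_sqrt.mpr hA
  have hsB : 1 ≤ √B := Real.one_le_sqrt.mpr hB
  have hs : 1 ≤ √A * √B := one_le_mul_of_one_le_of_one_le hsA hsB
  have hD0 : 0 ≤ D := Finset.sum_nonneg fun o _ => sq_nonneg _
  have hexp : D = A + B - 2 * ∑ o, √(a o) * √(b o) := by
    rw [hD, hAdef, hBdef, Finset.mul_sum, ← Finset.sum_add_distrib, ← Finset.sum_sub_distrib]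
    refine Finset.sum_congr rfl fun o _ => ?_
    linear_combination Real.sq_sqrt (ha o) + Real.sq_sqrt (hb o)
  have hsum : ∑ o, √(a o / A) * √(b o / B) = (∑ o, √(a o) * √(b o)) / (√A * √B) := by
    rw [Finset.sum_div]
    refine Finset.sum_congr rfl fun o _ => ?_
    rw [Real.sqrt_div (ha o), Real.sqrt_div (hb o), div_mul_div_comm]
  have hAM : 2 * (√A * √B) ≤ A + B := by
    have h1 := Real.sq_sqrt (zero_le_one.trans hA)
    have h2 := Real.sq_sqrt (zero_le_one.trans hB)
    nlinarith [sq_nonneg (√A - √B)]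
  -- The affinity is `(A + B - D) / (2 * √A * √B)`; AM-GM bounds `A + B` below, and `√A * √B ≥ 1`
  -- absorbs the denominator under `D`.
  rw [hsum, le_div_iff₀ (by linarith)]
  nlinarith

/-- Dividing `b - a` by `√b + √a ≥ √a` shows that a relative error `κ` of `a` is at most a relative
error `κ` of `√a`. -/
lemma sq_sqrt_sub_sqrt_le {a b κ : ℝ} (ha : 0 < a) (hb : 0 ≤ b) (h : |b - a| ≤ κ * a) :
    (√a - √b) ^ 2 ≤ κ ^ 2 * a := by
  have h1 := Real.sq_sqrt ha.le
  have h2 := Real.sq_sqrt hb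
  have hprod : (√b - √a) * (√b + √a) = b - a := by linear_combination h2 - h1
  have hsa : 0 < √a := Real.sqrt_pos.mpr ha
  have hsb := Real.sqrt_nonneg b
  have hle : |√b - √a| * √a ≤ κ * √a * √a := by
    calc |√b - √a| * √a ≤ |√b - √a| * (√b + √a) :=
          mul_le_mul_of_nonneg_left (by linarith) (abs_nonneg _)
      _ = |b - a| := by rw [← hprod, abs_mul, abs_of_nonneg (add_nonneg hsb hsa.le)]
      _ ≤ κ * a := h
      _ = κ * √a * √a := by rw [mul_assoc, Real.mul_self_sqrt ha.le]
  have hle' : |√b - √a| ≤ κ * √a := le_of_mul_le_mul_right hle hsa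
  calc (√a - √b) ^ 2 = |√b - √a| ^ 2 := by rw [sq_abs]; ring
    _ ≤ (κ * √a) ^ 2 := pow_le_pow_left₀ (abs_nonneg _) hle' 2
    _ = κ ^ 2 * a := by rw [mul_pow, h1]

/-- Relative perturbations by `u` of `x` and `X` perturb `x / √X` by at most `4 u`. -/
lemma abs_div_sqrt_sub_le {x y X Y u : ℝ} (hx : 0 ≤ x) (hX : 0 < X) (hu0 : 0 ≤ u)
    (hu : u ≤ 1 / 2) (hxy : |y - x| ≤ u * x) (hXY : |Y - X| ≤ u * X) :
    |y / √Y - x / √X| ≤ 4 * u * (x / √X) := by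
  obtain ⟨hxl, hxu⟩ := abs_le.mp hxy
  obtain ⟨hXl, hXu⟩ := abs_le.mp hXY
  have hY : 0 < Y := by nlinarith
  have hsX : 0 < √X := Real.sqrt_pos.mpr hX
  have hsY : 0 < √Y := Real.sqrt_pos.mpr hY
  have hlow : (1 - u) * √X ≤ √Y := by
    apply Real.le_sqrt_of_sq_le
    rw [mul_pow, Real.sq_sqrt hX.le]
    have : (1 - u) ^ 2 ≤ 1 - u := by nlinarith
    nlinarith
  have hup : √Y ≤ (1 + u) * √X := by
    rw [Real.sqrt_le_left (by positivity), mul_pow, Real.sq_sqrt hX.le]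
    have : 1 + u ≤ (1 + u) ^ 2 := by nlinarith
    nlinarith
  set q := x / √X with hq
  have hq0 : 0 ≤ q := div_nonneg hx hsX.le
  have hxq : x = q * √X := by rw [hq, div_mul_cancel₀ _ hsX.ne']
  have hqX : 0 ≤ q * √X := mul_nonneg hq0 hsX.le
  have huqX : 0 ≤ u * (q * √X) := mul_nonneg hu0 hqX
  rw [abs_le]
  constructor
  · have h : (1 - 4 * u) * q ≤ y / √Y := by
      rw [le_div_iff₀ hsY]
      rcases le_total (1 - 4 * u) 0 with hneg | hpos
      · have : 0 ≤ y := by nlinarith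
        nlinarith [mul_nonneg (mul_nonneg (neg_nonneg.mpr hneg) hq0) hsY.le]
      · have := mul_le_mul_of_nonneg_left hup (mul_nonneg hpos hq0)
        have h2 : (1 - 4 * u) * q * ((1 + u) * √X) ≤ (1 - u) * (q * √X) := by
          nlinarith [mul_nonneg hu0 huqX]
        rw [← hxq] at h2
        linarith
    linarith
  · have h : y / √Y ≤ (1 + 4 * u) * q := by
      rw [div_le_iff₀ hsY]
      have := mul_le_mul_of_nonneg_left hlow (mul_nonneg (by linarith : 0 ≤ 1 + 4 * u) hq0)
      have h2 : (1 + u) * (q * √X) ≤ (1 + 4 * u) * q * ((1 - u) * √X) := by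
        nlinarith [mul_nonneg (sub_nonneg.mpr hu) huqX]
      rw [← hxq] at h2
      linarith
    linarith

namespace NestedLogit

variable {M N : ℕ}

/-- Unnormalized purchase probabilities. -/
def choiceWeight (I : NestedLogit M N) (S : Assortment M N) : Purchase M N → ℝ
  | none => 1
  | some (i, j) => I.nestWeight i (S i) * I.itemProb S i j

lemma choiceProb_eq (I : NestedLogit M N) (S : Assortment M N) (o : Purchase M N) :
    I.choiceProb S o = I.choiceWeight S o / I.totalWeight S := by
  rcases o with _ | ⟨i, j⟩
  · rfl
  · simp only [choiceProb, choiceWeight, nestProb]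
    ring

lemma choiceWeight_nonneg (I : NestedLogit M N) (S : Assortment M N) (o : Purchase M N) :
    0 ≤ I.choiceWeight S o := by
  have h := I.choiceProb_nonneg S o
  rw [choiceProb_eq] at h
  by_contra hlt
  exact absurd h (not_le.mpr (div_neg_of_neg_of_pos (not_le.mp hlt) (I.totalWeight_pos S)))

lemma sum_choiceWeight (I : NestedLogit M N) (S : Assortment M N) :
    ∑ o, I.choiceWeight S o = I.totalWeight S := by
  have h := I.sum_choiceProb S
  simp only [choiceProb_eq] at h
  rwa [← Finset.sum_div, div_eq_one_iff_eq (I.totalWeight_pos S).ne'] at h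

lemma one_le_totalWeight (I : NestedLogit M N) (S : Assortment M N) : 1 ≤ I.totalWeight S :=
  le_add_of_nonneg_right (Finset.sum_nonneg fun i _ => I.nestWeight_nonneg i _)

lemma nestUtility_pos (I : NestedLogit M N) {i : Fin M} {A : Finset (Fin N)} {j : Fin N}
    (hj : j ∈ A) : 0 < I.nestUtility i A :=
  Finset.sum_pos (fun j _ => I.v_pos i j) ⟨j, hj⟩

lemma nestWeight_eq_sqrt {I : NestedLogit M N} {i : Fin M} (hγ : I.γ i = 1 / 2)
    (A : Finset (Fin N)) : I.nestWeight i A = √(I.nestUtility i A) := by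
  rw [I.nestWeight_eq_rpow (by rw [hγ]; norm_num), hγ, Real.sqrt_eq_rpow]

lemma choiceWeight_some {I : NestedLogit M N} {i : Fin M} (hγ : I.γ i = 1 / 2)
    (S : Assortment M N) (j : Fin N) :
    I.choiceWeight S (some (i, j)) =
      if j ∈ S i then I.v i j / √(I.nestUtility i (S i)) else 0 := by
  simp only [choiceWeight, itemProb, nestWeight_eq_sqrt hγ]
  split_ifs with h
  · have hV := I.nestUtility_pos (i := i) h
    rw [mul_div_assoc', div_eq_div_iff hV.ne' (Real.sqrt_pos.mpr hV).ne']
    linear_combination I.v i j * Real.mul_self_sqrt hV.le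
  · exact mul_zero _

/-- If two models differ only in the utilities of nest `i`, by a relative error of at most `u`, then
the purchase laws have affinity at least `1 - 8 u² √V`. -/
lemma one_sub_le_affinity {I J : NestedLogit M N} (hI : ∀ k, I.γ k = 1 / 2)
    (hJ : ∀ k, J.γ k = 1 / 2) {i : Fin M} (hne : ∀ k ≠ i, J.v k = I.v k) {u : ℝ} (hu0 : 0 ≤ u)
    (hu : u ≤ 1 / 2) (hi : ∀ j, |J.v i j - I.v i j| ≤ u * I.v i j) (S : Assortment M N) :
    1 - 8 * u ^ 2 * √(I.nestUtility i (S i)) ≤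
      ∑ o, √(I.choiceProb S o) * √(J.choiceProb S o) := by
  -- Normalization would couple all nests. The unnormalized weights differ only in nest `i`, and
  -- their mass is at least 1 thanks to the no-purchase option.
  have h := one_sub_le_affinity_div (I.choiceWeight_nonneg S) (J.choiceWeight_nonneg S)
    (by rw [sum_choiceWeight]; exact I.one_le_totalWeight S)
    (by rw [sum_choiceWeight]; exact J.one_le_totalWeight S)
  simp only [sum_choiceWeight, ← choiceProb_eq] at h
  refine le_trans ?_ h
  set V := I.nestUtility i (S i) with hV
  have hVV : |J.nestUtility i (S i) - V| ≤ u * V := by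
    rw [hV, nestUtility, nestUtility, ← Finset.sum_sub_distrib, Finset.mul_sum]
    exact (Finset.abs_sum_le_sum_abs _ _).trans (Finset.sum_le_sum fun j _ => hi j)
  have hother : ∀ k ≠ i, ∑ j, (√(I.choiceWeight S (some (k, j))) -
      √(J.choiceWeight S (some (k, j)))) ^ 2 = 0 := by
    intro k hk
    refine Finset.sum_eq_zero fun j _ => ?_
    rw [choiceWeight_some (hI k), choiceWeight_some (hJ k), nestUtility, nestUtility, hne k hk]
    simp
  have hitem : ∀ j, (√(I.choiceWeight S (some (i, j))) - √(J.choiceWeight S (some (i, j)))) ^ 2 ≤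
      if j ∈ S i then (4 * u) ^ 2 * (I.v i j / √V) else 0 := by
    intro j
    rw [choiceWeight_some (hI i), choiceWeight_some (hJ i)]
    split_ifs with hj
    · have hVpos : 0 < V := I.nestUtility_pos hj
      exact sq_sqrt_sub_sqrt_le (div_pos (I.v_pos i j) (Real.sqrt_pos.mpr hVpos))
        (div_nonneg (J.v_pos i j).le (Real.sqrt_nonneg _))
        (abs_div_sqrt_sub_le (I.v_pos i j).le hVpos hu0 hu (hi j) hVV)
    · simp
  have hD : ∑ o, (√(I.choiceWeight S o) - √(J.choiceWeight S o)) ^ 2 ≤ (4 * u) ^ 2 * √V := by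
    rw [Fintype.sum_option, Fintype.sum_prod_type,
      Finset.sum_eq_single i (fun k _ hk => hother k hk) (by simp)]
    have h0 : (√(I.choiceWeight S none) - √(J.choiceWeight S none)) ^ 2 = 0 := by
      simp [choiceWeight]
    rw [h0, zero_add]
    refine (Finset.sum_le_sum fun j _ => hitem j).trans (le_of_eq ?_)
    rw [Finset.sum_ite_mem, Finset.univ_inter, ← Finset.mul_sum, ← Finset.sum_div]
    change (4 * u) ^ 2 * (V / √V) = _
    rw [Real.div_sqrt]
  linarith

/-! ### Revenue as a sum of nest gains -/

/-- The gain `V_i(A)^{1/2} (R_i(A) - z)` of nest `i` with `γ_i = 1/2` over the revenue `z`. -/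
def nestGain (I : NestedLogit M N) (z : ℝ) (i : Fin M) (A : Finset (Fin N)) : ℝ :=
  (∑ j ∈ A, (I.r i j - z) * I.v i j) / √(I.nestUtility i A)

/-- Linearizes the fractional objective: relative to a fixed level `z`, the numerator separates over
nests. -/
lemma sub_expectedRevenue {I : NestedLogit M N} (hγ : ∀ i, I.γ i = 1 / 2) (z : ℝ)
    (S : Assortment M N) :
    z - I.expectedRevenue S = (z - ∑ i, I.nestGain z i (S i)) / I.totalWeight S := by
  have hgain : ∀ i, I.nestGain z i (S i) =
      I.nestWeight i (S i) * (∑ j ∈ S i, I.r i j * I.itemProb S i j) -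
        z * I.nestWeight i (S i) := by
    intro i
    rw [Finset.mul_sum, nestGain, Finset.sum_div, nestWeight_eq_sqrt (hγ i)]
    have hz : z * √(I.nestUtility i (S i)) =
        ∑ j ∈ S i, z * (I.v i j / √(I.nestUtility i (S i))) := by
      rw [← Finset.mul_sum, ← Finset.sum_div]
      change _ = z * (I.nestUtility i (S i) / _)
      rw [Real.div_sqrt]
    rw [hz, ← Finset.sum_sub_distrib]
    refine Finset.sum_congr rfl fun j hj => ?_
    have hw := choiceWeight_some (hγ i) S j
    rw [if_pos hj] at hw
    simp only [choiceWeight, nestWeight_eq_sqrt (hγ i)] at hw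
    linear_combination (- I.r i j) * hw
  have hW := (I.totalWeight_pos S).ne'
  have hR : I.expectedRevenue S =
      (∑ i, I.nestWeight i (S i) * (∑ j ∈ S i, I.r i j * I.itemProb S i j)) /
        I.totalWeight S := by
    rw [expectedRevenue, Finset.sum_div]
    refine Finset.sum_congr rfl fun i _ => ?_
    rw [nestProb]
    ring
  rw [hR, Finset.sum_congr rfl fun i _ => hgain i, Finset.sum_sub_distrib, ← Finset.mul_sum,
    eq_div_iff hW, sub_mul, div_mul_cancel₀ _ hW, totalWeight]
  ring

lemma expectedRevenue_le_optimalRevenue (I : NestedLogit M N) (S : Assortment M N) :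
    I.expectedRevenue S ≤ I.optimalRevenue :=
  Finset.le_sup' I.expectedRevenue (Finset.mem_univ S)

end NestedLogit

/-- The regret as the expected sum of the losses against the optimal revenue. -/
lemma regret_eq {M N : ℕ} (I : NestedLogit M N) (π : Policy M N) (T : ℕ) :
    regret I π T = ∑ t : Fin T, ∑ ω, (trajectoryLaw I π T ω).toReal *
      (I.optimalRevenue - I.expectedRevenue (ω t).1) := by
  refine Finset.sum_congr rfl fun t _ => ?_
  simp only [mul_sub, Finset.sum_sub_distrib]
  rw [← Finset.sum_mul, PMF.sum_toReal, one_mul, expectedRevenueAt]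

lemma regret_nonneg {M N : ℕ} (I : NestedLogit M N) (π : Policy M N) (T : ℕ) :
    0 ≤ regret I π T := by
  rw [regret_eq]
  exact Finset.sum_nonneg fun t _ => Finset.sum_nonneg fun ω _ =>
    mul_nonneg ENNReal.toReal_nonneg (sub_nonneg.mpr (I.expectedRevenue_le_optimalRevenue _))
end

/-! ### The two types of nest -/

noncomputable section

/-- Utility (in units of `1 / M²`) of the item of revenue `1`. -/
def topUtility (ε : ℝ) : Bool → ℝ
  | false => 1
  -- Solution `α` of `α / 3 + (2 + ε) ^ 2 / 6 = (2 + ε) / 2`, which makes the gain of the pair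
  -- exactly `1 / 2`.
  | true => 1 - (ε + ε ^ 2) / 2

/-- Total utility (in units of `1 / M²`) of the items of revenue `1` and `2 / 3`. -/
def pairUtility (ε : ℝ) : Bool → ℝ
  | false => (2 - ε) ^ 2
  | true => (2 + ε) ^ 2

/-- Utilities (in units of `1 / M²`) of the items of a nest of type `b`. With revenues `1`, `2 / 3`,
`0, …, 0`, it is optimal to offer only item `0` in a nest of type `false`, and items `0` and `1` in
a nest of type `true`, with the same gain. -/
def hardUtility (N : ℕ) (ε : ℝ) (b : Bool) (j : Fin N) : ℝ :=
  if j.val = 0 then topUtility ε b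
  else if j.val = 1 then pairUtility ε b - topUtility ε b else 1 / N

def hardRevenue (N : ℕ) (j : Fin N) : ℝ := if j.val = 0 then 1 else if j.val = 1 then 2 / 3 else 0

/-- The assortment is optimal for a nest of type `b`, up to items of revenue `0`. -/
def IsGoodChoice {N : ℕ} (hN : 2 ≤ N) (b : Bool) (A : Finset (Fin N)) : Prop :=
  (⟨0, by omega⟩ : Fin N) ∈ A ∧ ((⟨1, by omega⟩ : Fin N) ∈ A ↔ b = true)

lemma topUtility_bounds {ε : ℝ} (h0 : 0 < ε) (h1 : ε ≤ 1 / 16) (b : Bool) :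
    1 / 2 ≤ topUtility ε b ∧ topUtility ε b ≤ 1 := by
  cases b <;> simp only [topUtility] <;> constructor <;> nlinarith

lemma pairUtility_sub_bounds {ε : ℝ} (h0 : 0 < ε) (h1 : ε ≤ 1 / 16) (b : Bool) :
    2 ≤ pairUtility ε b - topUtility ε b ∧ pairUtility ε b - topUtility ε b ≤ 4 := by
  cases b <;> simp only [topUtility, pairUtility] <;> constructor <;> nlinarith

lemma hardUtility_pos {N : ℕ} {ε : ℝ} (h0 : 0 < ε) (h1 : ε ≤ 1 / 16) (b : Bool) (j : Fin N) :
    0 < hardUtility N ε b j := by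
  have ht := topUtility_bounds h0 h1 b
  have hp := pairUtility_sub_bounds h0 h1 b
  have hN : (0 : ℝ) < N := by exact_mod_cast j.pos
  unfold hardUtility
  split_ifs
  · linarith
  · linarith
  · positivity

lemma hardUtility_le {N : ℕ} {ε : ℝ} (h0 : 0 < ε) (h1 : ε ≤ 1 / 16) (b : Bool) (j : Fin N) :
    hardUtility N ε b j ≤ 4 := by
  have ht := topUtility_bounds h0 h1 b
  have hp := pairUtility_sub_bounds h0 h1 b
  have hN : (1 : ℝ) ≤ N := by exact_mod_cast j.pos
  unfold hardUtility
  split_ifs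
  · linarith
  · linarith
  · exact (div_le_one_of_le₀ hN (by linarith)).trans (by norm_num)

/-- Item 0 moves by about `ε / 2` from 1, item 1 by about `17 * ε / 2` from about 3, and the others
not at all. -/
lemma abs_hardUtility_sub_le {N : ℕ} {ε : ℝ} (h0 : 0 < ε) (h1 : ε ≤ 1 / 16) (j : Fin N) :
    |hardUtility N ε true j - hardUtility N ε false j| ≤ 4 * ε * hardUtility N ε false j := by
  have hpos := hardUtility_pos h0 h1 false j
  unfold hardUtility at hpos ⊢
  split_ifs at hpos ⊢
  · simp only [topUtility]
    rw [abs_le]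
    constructor <;> nlinarith
  · simp only [topUtility, pairUtility]
    rw [abs_le]
    constructor <;> nlinarith [mul_pos h0 h0, mul_pos h0 (mul_pos h0 h0)]
  · rw [sub_self, abs_zero]
    positivity

/-- Sums over an assortment split into the two good items and the items of revenue `0`. -/
lemma exists_sum_hardUtility {N : ℕ} (hN : 2 ≤ N) (ε : ℝ) (b : Bool) (A : Finset (Fin N)) :
    ∃ e : ℝ, 0 ≤ e ∧ e ≤ 1 ∧
      ∑ j ∈ A, hardUtility N ε b j =
        (if (⟨0, by omega⟩ : Fin N) ∈ A then topUtility ε b else 0) +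
          (if (⟨1, by omega⟩ : Fin N) ∈ A then pairUtility ε b - topUtility ε b else 0) + e ∧
      ∑ j ∈ A, (hardRevenue N j - 1 / 2) * hardUtility N ε b j =
        (if (⟨0, by omega⟩ : Fin N) ∈ A then topUtility ε b / 2 else 0) +
          (if (⟨1, by omega⟩ : Fin N) ∈ A then (pairUtility ε b - topUtility ε b) / 6 else 0) -
            e / 2 := by
  have hN0 : (0 : ℝ) < N := by exact_mod_cast (by omega : 0 < N)
  set x : Fin N → ℝ := fun j => if j.val = 0 then 0 else if j.val = 1 then 0 else 1 / N with hx
  have hx0 : ∀ j, 0 ≤ x j := by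
    intro j
    simp only [hx]
    split_ifs <;> positivity
  have hx1 : ∀ j, x j ≤ 1 / N := by
    intro j
    simp only [hx]
    split_ifs
    · positivity
    · positivity
    · exact le_rfl
  refine ⟨∑ j ∈ A, x j, Finset.sum_nonneg fun j _ => hx0 j, ?_, ?_, ?_⟩
  · calc ∑ j ∈ A, x j ≤ ∑ j, x j :=
          Finset.sum_le_sum_of_subset_of_nonneg (Finset.subset_univ _) fun j _ _ => hx0 j
      _ ≤ ∑ _j : Fin N, 1 / (N : ℝ) := Finset.sum_le_sum fun j _ => hx1 j
      _ = 1 := by simp [hN0.ne']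
  · rw [← Finset.sum_ite_eq' A (⟨0, by omega⟩ : Fin N) fun _ => topUtility ε b,
      ← Finset.sum_ite_eq' A (⟨1, by omega⟩ : Fin N) fun _ => pairUtility ε b - topUtility ε b,
      ← Finset.sum_add_distrib, ← Finset.sum_add_distrib]
    refine Finset.sum_congr rfl fun j _ => ?_
    simp only [hardUtility, hx, Fin.ext_iff]
    split_ifs <;> first | omega | ring
  · rw [← Finset.sum_ite_eq' A (⟨0, by omega⟩ : Fin N) fun _ => topUtility ε b / 2,
      ← Finset.sum_ite_eq' A (⟨1, by omega⟩ : Fin N)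
        fun _ => (pairUtility ε b - topUtility ε b) / 6,
      ← Finset.sum_add_distrib, Finset.sum_div, ← Finset.sum_sub_distrib]
    refine Finset.sum_congr rfl fun j _ => ?_
    simp only [hardUtility, hardRevenue, hx, Fin.ext_iff]
    split_ifs <;> first | omega | ring

lemma sum_hardUtility_le {N : ℕ} (hN : 2 ≤ N) {ε : ℝ} (h0 : 0 < ε) (h1 : ε ≤ 1 / 16) (b : Bool)
    (A : Finset (Fin N)) : √(∑ j ∈ A, hardUtility N ε b j) ≤ 3 := by
  obtain ⟨e, he0, he1, hX, -⟩ := exists_sum_hardUtility hN ε b A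
  have ht := topUtility_bounds h0 h1 b
  have hp := pairUtility_sub_bounds h0 h1 b
  rw [Real.sqrt_le_left (by norm_num), hX]
  split_ifs <;> linarith

open Classical in
/-- Every choice but the good ones loses at least `ε / 24` of the optimal gain `1 / 2`. -/
lemma hardGain_le {N : ℕ} (hN : 2 ≤ N) {ε : ℝ} (h0 : 0 < ε) (h1 : ε ≤ 1 / 16) (b : Bool)
    (A : Finset (Fin N)) :
    ∑ j ∈ A, (hardRevenue N j - 1 / 2) * hardUtility N ε b j ≤
      (1 / 2 - if IsGoodChoice hN b A then 0 else ε / 24) *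
        √(∑ j ∈ A, hardUtility N ε b j) := by
  obtain ⟨e, he0, he1, hX, hP⟩ := exists_sum_hardUtility hN ε b A
  have ht := topUtility_bounds h0 h1 b
  have hp := pairUtility_sub_bounds h0 h1 b
  set c : ℝ := 1 / 2 - if IsGoodChoice hN b A then 0 else ε / 24 with hc
  have hc0 : 0 ≤ c := by
    rw [hc]
    split_ifs <;> linarith
  -- Items of revenue 0 lower the numerator and raise the utility, so they can be discarded.
  have key : ∀ {P X : ℝ}, P ≤ c * √X → P - e / 2 ≤ c * √(X + e) := by
    intro P X h
    have := mul_le_mul_of_nonneg_left (Real.sqrt_le_sqrt (by linarith : X ≤ X + e)) hc0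
    linarith
  rw [hX, hP]
  apply key
  by_cases hA0 : (⟨0, by omega⟩ : Fin N) ∈ A <;> by_cases hA1 : (⟨1, by omega⟩ : Fin N) ∈ A <;>
    simp only [hA0, hA1, if_true, if_false, add_zero, zero_add, add_sub_cancel]
  · cases b
    · have hg : ¬ IsGoodChoice hN false A := by simp [IsGoodChoice, hA1]
      rw [hc, if_neg hg]
      simp only [topUtility, pairUtility]
      rw [Real.sqrt_sq (by linarith)]
      nlinarith
    · have hg : IsGoodChoice hN true A := by simp [IsGoodChoice, hA0, hA1]
      rw [hc, if_pos hg]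
      simp only [topUtility, pairUtility]
      rw [Real.sqrt_sq (by linarith)]
      nlinarith
  · cases b
    · have hg : IsGoodChoice hN false A := by simp [IsGoodChoice, hA0, hA1]
      rw [hc, if_pos hg]
      simp [topUtility]
    · have hg : ¬ IsGoodChoice hN true A := by simp [IsGoodChoice, hA1]
      rw [hc, if_neg hg]
      -- Item 0 alone gains half of this square root.
      have hs : √(topUtility ε true) ≤ 1 - ε / 12 := by
        rw [Real.sqrt_le_left (by linarith)]
        simp only [topUtility]
        nlinarith
      have hs0 := Real.sqrt_nonneg (topUtility ε true)
      have hsq := Real.sq_sqrt (by linarith : 0 ≤ topUtility ε true)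
      nlinarith
  · have hg : ¬ IsGoodChoice hN b A := by simp [IsGoodChoice, hA0]
    rw [hc, if_neg hg]
    set β := pairUtility ε b - topUtility ε b
    -- Item 1 alone gains `√β / 6 ≤ 1 / 3`, well below `1 / 2`.
    have hs : √β ≤ 2 := by
      rw [Real.sqrt_le_left (by norm_num)]
      linarith
    have hs0 := Real.sqrt_nonneg β
    have hsq := Real.sq_sqrt (by linarith : 0 ≤ β)
    nlinarith
  · simp

/-- Nested logit model whose nest `i` has type `θ i`. -/
def hardInstance {M : ℕ} (N : ℕ) (hM : 0 < M) {ε : ℝ} (h0 : 0 < ε) (h1 : ε ≤ 1 / 16)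
    (θ : Fin M → Bool) : NestedLogit M N where
  r _ j := hardRevenue N j
  v i j := hardUtility N ε (θ i) j / (M : ℝ) ^ 2
  γ _ := 1 / 2
  v_pos i j := div_pos (hardUtility_pos h0 h1 _ j) (by positivity)
  γ_mem _ := ⟨by norm_num, by norm_num⟩

/-! ### Revenue and losses in the hard models -/

section
variable {M N : ℕ} (hM : 0 < M) {ε : ℝ} (h0 : 0 < ε) (h1 : ε ≤ 1 / 16) (θ : Fin M → Bool)

lemma hardInstance_mem (hM2 : 2 ≤ M) {C : ℝ} (hC : 1 ≤ C) :
    hardInstance N hM h0 h1 θ ∈ halfInstances M N C := by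
  refine ⟨fun i j => ?_, fun i j => ⟨NestedLogit.v_pos _ i j, ?_⟩, fun i => rfl⟩
  · simp only [hardInstance, hardRevenue]
    split_ifs <;> norm_num
  · have h2 : (2 : ℝ) ≤ M := by exact_mod_cast hM2
    have h4 : (4 : ℝ) ≤ (M : ℝ) ^ 2 := by nlinarith
    exact (div_le_one_of_le₀ ((hardUtility_le h0 h1 _ j).trans h4) (by positivity)).trans hC

lemma sqrt_nestUtility_hardInstance (i : Fin M) (A : Finset (Fin N)) :
    √((hardInstance N hM h0 h1 θ).nestUtility i A) =
      √(∑ j ∈ A, hardUtility N ε (θ i) j) / M := by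
  simp only [NestedLogit.nestUtility, hardInstance]
  rw [← Finset.sum_div, Real.sqrt_div' _ (by positivity), Real.sqrt_sq (by positivity)]

lemma nestGain_hardInstance (i : Fin M) (A : Finset (Fin N)) :
    (hardInstance N hM h0 h1 θ).nestGain (1 / 2) i A =
      (∑ j ∈ A, (hardRevenue N j - 1 / 2) * hardUtility N ε (θ i) j) /
        √(∑ j ∈ A, hardUtility N ε (θ i) j) / M := by
  have hM0 : (M : ℝ) ≠ 0 := by exact_mod_cast hM.ne'
  rw [NestedLogit.nestGain, sqrt_nestUtility_hardInstance]
  simp only [hardInstance, ← mul_div_assoc]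
  rw [← Finset.sum_div]
  generalize ∑ j ∈ A, (hardRevenue N j - 1 / 2) * hardUtility N ε (θ i) j = P
  field_simp

lemma totalWeight_hardInstance_le (hN : 2 ≤ N) (S : Assortment M N) :
    (hardInstance N hM h0 h1 θ).totalWeight S ≤ 4 := by
  have hM0 : (0 : ℝ) < M := by exact_mod_cast hM
  have h : ∑ i, (hardInstance N hM h0 h1 θ).nestWeight i (S i) ≤ ∑ _i : Fin M, 3 / (M : ℝ) := by
    refine Finset.sum_le_sum fun i _ => ?_
    rw [NestedLogit.nestWeight_eq_sqrt rfl, sqrt_nestUtility_hardInstance]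
    exact div_le_div_of_nonneg_right (sum_hardUtility_le hN h0 h1 _ _) hM0.le
  have h3 : ∑ _i : Fin M, 3 / (M : ℝ) = 3 := by
    rw [Finset.sum_const, Finset.card_univ, Fintype.card_fin, nsmul_eq_mul,
      mul_div_cancel₀ _ hM0.ne']
  unfold NestedLogit.totalWeight
  linarith

lemma half_le_optimalRevenue_hardInstance (hN : 2 ≤ N) :
    1 / 2 ≤ (hardInstance N hM h0 h1 θ).optimalRevenue := by
  have hM0 : (0 : ℝ) < M := by exact_mod_cast hM
  set i0 : Fin N := ⟨0, by omega⟩ with hi0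
  set i1 : Fin N := ⟨1, by omega⟩ with hi1
  have hne : i0 ≠ i1 := by simp [hi0, hi1]
  set S : Assortment M N := fun i => if θ i = true then {i0, i1} else {i0} with hS
  refine le_trans ?_ (NestedLogit.expectedRevenue_le_optimalRevenue _ S)
  have hgain : ∀ i, (hardInstance N hM h0 h1 θ).nestGain (1 / 2) i (S i) = 1 / 2 / M := by
    intro i
    rw [nestGain_hardInstance]
    congr 1
    simp only [hS]
    cases hθ : θ i
    · simp [hardUtility, hardRevenue, hi0, topUtility]
      norm_num
    · rw [if_pos rfl, Finset.sum_pair hne, Finset.sum_pair hne]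
      have hX : hardUtility N ε true i0 + hardUtility N ε true i1 = (2 + ε) ^ 2 := by
        simp [hardUtility, hi0, hi1, pairUtility]
      rw [hX, Real.sqrt_sq (by linarith), div_eq_iff (by linarith)]
      simp [hardUtility, hardRevenue, hi0, hi1, pairUtility, topUtility]
      ring
  have h := NestedLogit.sub_expectedRevenue (I := hardInstance N hM h0 h1 θ) (fun _ => rfl)
    (1 / 2) S
  have hsum : ∑ i : Fin M, (1 : ℝ) / 2 / M = 1 / 2 := by
    rw [Finset.sum_const, Finset.card_univ, Fintype.card_fin, nsmul_eq_mul,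
      mul_div_cancel₀ _ hM0.ne']
  rw [Finset.sum_congr rfl fun i _ => hgain i, hsum, sub_self, zero_div] at h
  linarith

open Classical in
/-- Every nest with a bad choice costs at least `ε / (96 M)`. -/
lemma sum_loss_le_hardInstance (hN : 2 ≤ N) (S : Assortment M N) :
    ∑ i, (if IsGoodChoice hN (θ i) (S i) then 0 else ε / (96 * M)) ≤
      (hardInstance N hM h0 h1 θ).optimalRevenue -
        (hardInstance N hM h0 h1 θ).expectedRevenue S := by
  have hM0 : (0 : ℝ) < M := by exact_mod_cast hM
  set I := hardInstance N hM h0 h1 θ with hI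
  -- The factor 4 anticipates division by a total weight of at most 4; `4 * ε / (96 * M)` is `ε /
  -- (24 * M)`.
  have hgain : ∀ i, I.nestGain (1 / 2) i (S i) ≤
      1 / 2 / M - 4 * (if IsGoodChoice hN (θ i) (S i) then 0 else ε / (96 * M)) := by
    intro i
    rw [hI, nestGain_hardInstance]
    have h := hardGain_le hN h0 h1 (θ i) (S i)
    have hc : (0 : ℝ) ≤ 1 / 2 - if IsGoodChoice hN (θ i) (S i) then 0 else ε / 24 := by
      split_ifs <;> linarith
    have h2 := div_le_div_of_nonneg_right (div_le_of_le_mul₀ (Real.sqrt_nonneg _) hc h) hM0.le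
    refine h2.trans (le_of_eq ?_)
    split_ifs <;> field_simp <;> ring
  have hsum : ∑ i : Fin M, (1 : ℝ) / 2 / M = 1 / 2 := by
    rw [Finset.sum_const, Finset.card_univ, Fintype.card_fin, nsmul_eq_mul,
      mul_div_cancel₀ _ hM0.ne']
  have htot := Finset.sum_le_sum fun i (_ : i ∈ Finset.univ) => hgain i
  rw [Finset.sum_sub_distrib, hsum, ← Finset.mul_sum] at htot
  have hR := NestedLogit.sub_expectedRevenue (I := I) (fun _ => rfl) (1 / 2) S
  have hopt := half_le_optimalRevenue_hardInstance hM h0 h1 θ hN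
  set L := ∑ i, (if IsGoodChoice hN (θ i) (S i) then 0 else ε / (96 * M))
  have hL : 0 ≤ L := Finset.sum_nonneg fun i _ => by split_ifs <;> positivity
  have hW := totalWeight_hardInstance_le hM h0 h1 θ hN S
  have hLR : L ≤ 1 / 2 - I.expectedRevenue S := by
    rw [hR, le_div_iff₀ (I.totalWeight_pos S)]
    nlinarith
  linarith

/-! ### Two-point bound for each nest and averaging over types -/

open Classical in
/-- Expected cost of bad choices for nest `i` in one period, summed over the two types of the
nest. -/
lemma le_expected_bad_add (hN : 2 ≤ N) {T : ℕ} (hT : T * (384 * ε ^ 2 / M) ≤ 1 / 2) (hT0 : 0 < T)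
    (π : Policy M N) (i : Fin M) {θ' : Fin M → Bool} (hθ : θ i = false) (hθ' : θ' i = true)
    (hne : ∀ k ≠ i, θ' k = θ k) (t : Fin T) :
    ε / (96 * M) / 8 ≤
      ∑ ω, (trajectoryLaw (hardInstance N hM h0 h1 θ) π T ω).toReal *
          (if IsGoodChoice hN (θ i) ((ω t).1 i) then 0 else ε / (96 * M)) +
        ∑ ω, (trajectoryLaw (hardInstance N hM h0 h1 θ') π T ω).toReal *
          (if IsGoodChoice hN (θ' i) ((ω t).1 i) then 0 else ε / (96 * M)) := by
  have hM0 : (0 : ℝ) < M := by exact_mod_cast hM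
  have hη0 : (0 : ℝ) ≤ 384 * ε ^ 2 / M := by positivity
  have hη1 : 384 * ε ^ 2 / M ≤ (1 : ℝ) := by
    have : (1 : ℝ) ≤ T := by exact_mod_cast hT0
    nlinarith
  have hδ : 0 ≤ ε / (96 * M) := by positivity
  refine mul_le_expected_loss_add (I := hardInstance N hM h0 h1 θ)
    (J := hardInstance N hM h0 h1 θ') rfl π hη1 hT ?_
    (f := fun S => if IsGoodChoice hN (θ i) (S i) then 0 else ε / (96 * M))
    (g := fun S => if IsGoodChoice hN (θ' i) (S i) then 0 else ε / (96 * M)) ?_ ?_ hδ ?_ t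
  · intro S
    refine le_trans ?_ (NestedLogit.one_sub_le_affinity (fun _ => rfl) (fun _ => rfl) (i := i)
      (u := 4 * ε) ?_ (by linarith) (by linarith) ?_ S)
    · rw [sqrt_nestUtility_hardInstance]
      have h := sum_hardUtility_le hN h0 h1 (θ i) (S i)
      have h2 : 8 * (4 * ε) ^ 2 * (√(∑ j ∈ S i, hardUtility N ε (θ i) j) / M) ≤
          8 * (4 * ε) ^ 2 * (3 / M) := by gcongr
      have h3 : 8 * (4 * ε) ^ 2 * (3 / M) = 384 * ε ^ 2 / M := by ring
      linarith
    · intro k hk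
      simp only [hardInstance, hne k hk]
    · intro j
      simp only [hardInstance, hθ, hθ']
      rw [← sub_div, abs_div, abs_of_pos (by positivity : (0 : ℝ) < (M : ℝ) ^ 2), ← mul_div_assoc]
      exact div_le_div_of_nonneg_right (abs_hardUtility_sub_le h0 h1 j) (by positivity)
  · intro S
    split_ifs <;> simp [hδ]
  · intro S
    split_ifs <;> simp [hδ]
  · intro S
    -- The two types disagree on whether item 1 belongs, so every assortment is bad for at least one
    -- of them.
    have hnot : IsGoodChoice hN (θ i) (S i) → ¬ IsGoodChoice hN (θ' i) (S i) := by
      rw [hθ, hθ']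
      exact fun ha hb => Bool.false_ne_true (ha.2.mp (hb.2.mpr rfl))
    by_cases ha : IsGoodChoice hN (θ i) (S i)
    · simp [ha, hnot ha]
    · rw [if_neg ha]
      split_ifs <;> linarith

open Classical in
/-- Averaging over the types of all nests yields a model with large regret. -/
lemma exists_le_regret_hardInstance (hN : 2 ≤ N) {T : ℕ} (hT : T * (384 * ε ^ 2 / M) ≤ 1 / 2)
    (hT0 : 0 < T) (π : Policy M N) :
    ∃ θ : Fin M → Bool, T * ε / 1536 ≤ regret (hardInstance N hM h0 h1 θ) π T := by
  have hM0 : (0 : ℝ) < M := by exact_mod_cast hM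
  set bad : Fin M → Fin T → (Fin M → Bool) → ℝ := fun i t θ =>
    ∑ ω, (trajectoryLaw (hardInstance N hM h0 h1 θ) π T ω).toReal *
      (if IsGoodChoice hN (θ i) ((ω t).1 i) then 0 else ε / (96 * M)) with hbad
  have hreg : ∀ θ, ∑ t, ∑ i, bad i t θ ≤ regret (hardInstance N hM h0 h1 θ) π T := by
    intro θ
    rw [regret_eq]
    refine Finset.sum_le_sum fun t _ => ?_
    rw [Finset.sum_comm]
    refine Finset.sum_le_sum fun ω _ => ?_
    rw [← Finset.mul_sum]
    exact mul_le_mul_of_nonneg_left (sum_loss_le_hardInstance hM h0 h1 θ hN _)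
      ENNReal.toReal_nonneg
  have hflip : ∀ i t, ∑ _θ : Fin M → Bool, ε / (96 * M) / 16 ≤ ∑ θ, bad i t θ := by
    intro i t
    -- Flipping bit `i` permutes the type vectors, so each sum over types is half the sum over the
    -- pairs `θ`, `flip θ`.
    set flip : (Fin M → Bool) → (Fin M → Bool) := fun θ => Function.update θ i (!θ i) with hfl
    have hinv : Function.Involutive flip := by
      intro θ
      simp [hfl]
    have hpair : ∀ θ, ε / (96 * M) / 8 ≤ bad i t θ + bad i t (flip θ) := by
      intro θ
      cases hθ : θ i
      · exact le_expected_bad_add hM h0 h1 θ hN hT hT0 π i hθ (by simp [hfl, hθ])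
          (fun k hk => by simp [hfl, hk]) t
      · rw [add_comm]
        exact le_expected_bad_add hM h0 h1 (flip θ) hN hT hT0 π i (by simp [hfl, hθ]) hθ
          (fun k hk => by simp [hfl, hk]) t
    have hsum := Finset.sum_le_sum fun θ (_ : θ ∈ Finset.univ) => hpair θ
    rw [Finset.sum_add_distrib] at hsum
    have hcomp : ∑ θ, bad i t (flip θ) = ∑ θ, bad i t θ :=
      Equiv.sum_comp (Function.Involutive.toPerm flip hinv) (bad i t)
    rw [hcomp] at hsum
    have h2 : ∑ _θ : Fin M → Bool, ε / (96 * M) / 8 =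
        2 * ∑ _θ : Fin M → Bool, ε / (96 * M) / 16 := by
      rw [Finset.mul_sum]
      exact Finset.sum_congr rfl fun _ _ => by ring
    linarith
  have hle : ∑ _θ : Fin M → Bool, T * ε / 1536 ≤
      ∑ θ, regret (hardInstance N hM h0 h1 θ) π T := by
    calc ∑ _θ : Fin M → Bool, T * ε / 1536
        = ∑ _t : Fin T, ∑ _i : Fin M, ∑ _θ : Fin M → Bool, ε / (96 * M) / 16 := by
          simp only [Finset.sum_const, Finset.card_univ, Fintype.card_fin, nsmul_eq_mul]
          field_simp
          norm_num
      _ ≤ ∑ t, ∑ i, ∑ θ, bad i t θ :=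
          Finset.sum_le_sum fun t _ => Finset.sum_le_sum fun i _ => hflip i t
      _ = ∑ θ, ∑ t, ∑ i, bad i t θ := by
          rw [Finset.sum_comm]
          simp only [Finset.sum_comm (s := (Finset.univ : Finset (Fin T)))]
          rw [Finset.sum_comm]
      _ ≤ _ := Finset.sum_le_sum fun θ _ => hreg θ
  obtain ⟨θ, -, hθ⟩ := Finset.exists_le_of_sum_le Finset.univ_nonempty hle
  exact ⟨θ, hθ⟩

end
end

/-! ### Choice of the gap -/

theorem theorem2 :
    ∃ C₀ : ℝ, 0 < C₀ ∧
      ∀ M N T : ℕ, 4 ∣ M → 3 ≤ N → M ≤ T →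
        ∀ C_V : ℝ, 1 ≤ C_V →
          ∀ π : Policy M N,
            ((C₀ * Real.sqrt ((M : ℝ) * (T : ℝ)) : ℝ) : EReal) ≤
              ⨆ I ∈ halfInstances M N C_V, ((regret I π T : ℝ) : EReal) := by
  -- `49152 = 32 * 1536`, from `ε = √(M / T) / 32` and the regret bound `T * ε / 1536`.
  refine ⟨1 / 49152, by norm_num, fun M N T hM4 hN hMT C_V hC π => ?_⟩
  suffices h : ∃ I ∈ halfInstances M N C_V, 1 / 49152 * √((M : ℝ) * T) ≤ regret I π T by
    obtain ⟨I, hI, hle⟩ := h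
    exact (EReal.coe_le_coe_iff.mpr hle).trans
      (le_iSup₂ (f := fun I (_ : I ∈ halfInstances M N C_V) => ((regret I π T : ℝ) : EReal)) I hI)
  rcases Nat.eq_zero_or_pos M with rfl | hM
  -- For `M = 0` the bound is 0, and the empty model suffices.
  · refine ⟨⟨fun i => i.elim0, fun i => i.elim0, fun i => i.elim0, fun i => i.elim0,
      fun i => i.elim0⟩, ⟨fun i => i.elim0, fun i => i.elim0, fun i => i.elim0⟩, ?_⟩
    simpa using regret_nonneg _ π T
  -- Ensures `4 / M ^ 2 ≤ 1 ≤ C_V`, so the scaled utilities are admissible.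
  · have hM2 : 2 ≤ M := by omega
    have hT : 0 < T := by omega
    have hM0 : (0 : ℝ) < M := by exact_mod_cast hM
    have hT0 : (0 : ℝ) < T := by exact_mod_cast hT
    have hMT' : (M : ℝ) / T ≤ 1 := div_le_one_of_le₀ (by exact_mod_cast hMT) hT0.le
    -- Makes `T * (384 * ε ^ 2 / M) = 384 / 1024`, below the threshold `1 / 2`; `M ≤ T` keeps `ε`
    -- small.
    set ε : ℝ := √((M : ℝ) / T) / 32 with hε
    have h0 : 0 < ε := by positivity
    have h1 : ε ≤ 1 / 16 := by
      have := Real.sqrt_le_one.mpr hMT'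
      rw [hε]
      linarith
    have hsq : ε ^ 2 = M / T / 1024 := by
      rw [hε, div_pow, Real.sq_sqrt (by positivity)]
      norm_num
    have hTε : T * ε = √((M : ℝ) * T) / 32 := by
      have : (M : ℝ) * T = M / T * T ^ 2 := by field_simp
      rw [this, Real.sqrt_mul (by positivity), Real.sqrt_sq hT0.le, hε]
      ring
    have hη : T * (384 * ε ^ 2 / M) ≤ 1 / 2 := by
      rw [hsq]
      field_simp
      norm_num
    obtain ⟨θ, hθ⟩ := exists_le_regret_hardInstance hM h0 h1 (by omega : 2 ≤ N) hη hT π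
    refine ⟨_, hardInstance_mem hM h0 h1 θ hM2 hC, le_trans (le_of_eq ?_) hθ⟩
    rw [hTε]
    ring
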